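/- For a finite graph $G$, a set $D\subseteq V_G$ is dominating if every vertex of $V_G\setminus D$ has a neighbor in $D$, and $\gamma(G)$ is the minimum cardinality of a dominating set. A vertex $v$ is $\gamma^-$-critical in $G$ if $\gamma(G-v)<\gamma(G)$. A leaf is a vertex of degree one and a support is a vertex adjacent to a leaf; $L_G$ and $S_G$ denote the sets of leaves and supports of $G$, and $N_G(v)$ is the set of neighbors of $v$. Let $\mathcal{T}_{\max}$ be the set of finite trees $T$ for which $\gamma(T)$ equals the size of the smaller partite set of $T$. Let $\mathcal{T}$ be the family of all trees $T$ for which there is a sequence of trees $T_0,\dots,T_k$ with $k\ge 0$, $T_0=K_2$, $T_k=T$, such that each $T_i$ ($1\le i\le k$) is obtained from $T'=T_{i-1}$, with a bipartition $(A',B')$ of $T'$ such that $|A'|\le|B'|$, by one of the following operations. - $\mathcal{O}_1$: Add a new vertex $b$ to $T'$ and join $b$ to a vertex $a'\in A'$. - $\mathcal{O}_2$: Add a new vertex $a$ to $T'$ and join $a$ to a vertex $b'\in B'$ such that $N_{T'}(b')\subseteq S_{T'}$ and $b'\notin L_{T'}$. - $\mathcal{O}_3$: Add two new vertices $a$ and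 $b$ to $T'$ and join $b$ to $a$ and to a vertex $a'\in A'$ that is a support of $T'$. - $\mathcal{O}_4$: Add two new vertices $a$ and $b$ to $T'$ and join $a$ to $b$ and to a vertex $b'\in B'$ that is not $\gamma^-$-critical in $T'$. **Theorem.** A finite tree $T$ belongs to $\mathcal{T}_{\max}$ if and only if it belongs to $\mathcal{T}$. The same equivalence holds if the bipartition is instead carried along the sequence: $T_0=K_2$ is given an arbitrary bipartition, and in each operation the bipartition of the new tree is the one that extends $(A',B')$ (so new vertices named $a$ join $A'$ and new vertices named $b$ join $B'$). -/

import Mathlib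

universe u

namespace TreeDom

variable {V W : Type u}

/-- `D` is a dominating set of `G`: every vertex outside `D` has a neighbour in `D`. -/
def IsDominating (G : SimpleGraph V) (D : Set V) : Prop :=
  ∀ v, v ∉ D → ∃ u ∈ D, G.Adj v u

/-- The domination number `γ(G)` of a finite graph: the minimum size of a dominating set. -/
noncomputable def dominationNumber (G : SimpleGraph V) : ℕ :=
  sInf {n | ∃ D : Finset V, IsDominating G (D : Set V) ∧ D.card = n}

/-- `v` is `γ⁻`-critical in `G`: `γ(G - v) < γ(G)`. -/
def IsGammaMinusCritical (G : SimpleGraph V) (v : V) : Prop :=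
  dominationNumber (G.induce ({v}ᶜ : Set V)) < dominationNumber G

/-- A leaf is a vertex of degree one, i.e. a vertex with exactly one neighbour. -/
def IsLeaf (G : SimpleGraph V) (v : V) : Prop :=
  ∃! u, G.Adj v u

/-- A support vertex is a vertex adjacent to a leaf. -/
def IsSupport (G : SimpleGraph V) (v : V) : Prop :=
  ∃ u, G.Adj v u ∧ IsLeaf G u

/-- `(A, B)` is a bipartition of `G`: `A` and `B` partition the vertex set and every edge of `G`
joins a vertex of `A` with a vertex of `B`. -/
def IsBipartition (G : SimpleGraph V) (A B : Set V) : Prop :=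
  G.IsBipartiteWith A B ∧ A ∪ B = Set.univ

/-- The family `T_max`: trees whose domination number is the size of the smaller partite set. -/
def InTmax (T : SimpleGraph V) : Prop :=
  T.IsTree ∧ ∃ A B : Set V, IsBipartition T A B ∧ A.ncard ≤ B.ncard ∧
    dominationNumber T = A.ncard

/-- `T` is `T'` (identified with an induced subgraph of `T` by `f`) together with one new vertex
`x`, joined exactly to the vertex `p` of `T'`. -/
def AttachVertex {T' : SimpleGraph W} {T : SimpleGraph V} (f : T' ↪g T) (p : W) (x : V) : Prop :=
  Set.range f = {x}ᶜ ∧ ∀ z, T.Adj x z ↔ z = f p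

/-- `T` is `T'` (identified with an induced subgraph of `T` by `f`) together with two new vertices
`x`, `y`, where `x` is joined exactly to `y` and to the vertex `p` of `T'`,
and `y` is joined exactly to `x`. -/
def AttachPath {T' : SimpleGraph W} {T : SimpleGraph V} (f : T' ↪g T) (p : W) (x y : V) : Prop :=
  x ≠ y ∧ Set.range f = {x, y}ᶜ ∧ (∀ z, T.Adj x z ↔ z = y ∨ z = f p) ∧ ∀ z, T.Adj y z ↔ z = x

/-- `T` arises from the tree `T'` with bipartition `(A', B')` by one of the four operations;
`f` is the inclusion of `T'` in `T`. -/
inductive Operation {T' : SimpleGraph W} {T : SimpleGraph V} (f : T' ↪g T) (A' B' : Set W) : Prop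
  | O1 (a' : W) (ha' : a' ∈ A') (b : V) (h : AttachVertex f a' b)
  | O2 (b' : W) (hb' : b' ∈ B') (hN : ∀ u, T'.Adj b' u → IsSupport T' u) (hL : ¬ IsLeaf T' b')
      (a : V) (h : AttachVertex f b' a)
  | O3 (a' : W) (ha' : a' ∈ A') (hS : IsSupport T' a') (a b : V) (h : AttachPath f a' b a)
  | O4 (b' : W) (hb' : b' ∈ B') (hcrit : ¬ IsGammaMinusCritical T' b') (a b : V)
      (h : AttachPath f b' a b)

/-- The family of trees obtained from `K₂` by repeated use of the four operations, where an
operation may be applied to `T'` with respect to any bipartition `(A', B')` of `T'` such that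
`|A'| ≤ |B'|`. -/
inductive InFamily : {V : Type u} → SimpleGraph V → Prop
  | base {V : Type u} (T : SimpleGraph V)
      (h : Nonempty (T ≃g (⊤ : SimpleGraph (Fin 2)))) : InFamily T
  | step {W V : Type u} (T' : SimpleGraph W) (T : SimpleGraph V) (f : T' ↪g T) (A' B' : Set W)
      (hT' : InFamily T') (hAB : IsBipartition T' A' B') (hle : A'.ncard ≤ B'.ncard)
      (hop : Operation f A' B') : InFamily T

/-- The variant in which the bipartition is carried along: `K₂` gets an arbitrary bipartition, and
after each operation the bipartition of the new tree extends that of the old one. -/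
inductive InLabelledFamily : {V : Type u} → SimpleGraph V → Set V → Set V → Prop
  | base {V : Type u} (T : SimpleGraph V) (A B : Set V)
      (h : Nonempty (T ≃g (⊤ : SimpleGraph (Fin 2)))) (hAB : IsBipartition T A B) :
      InLabelledFamily T A B
  | step {W V : Type u} (T' : SimpleGraph W) (T : SimpleGraph V) (f : T' ↪g T)
      (A' B' : Set W) (A B : Set V) (hT' : InLabelledFamily T' A' B')
      (hop : Operation f A' B') (hAB : IsBipartition T A B)
      (hA : f '' A' ⊆ A) (hB : f '' B' ⊆ B) : InLabelledFamily T A B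

end TreeDom

namespace TreeDom

/-! ### Minimum dominating sets and support vertices. -/

section Domination

variable {V W : Type u} {G : SimpleGraph V}

/-! In a nontrivial connected bipartite graph each partite set is dominating, so `γ ≤ |A|` and `γ ≤
|B|`. Hence `γ = |A|` already forces `|A| ≤ |B|`, and both families can be compared with the single
invariant `γ(T) = |A|` (`IsExtremal`).

Operations preserve the invariant. By `Operation.add_ncard_le`, each one raises `γ` by at least the
number of vertices it adds to `A`, and `γ(T) ≤ |A|` gives equality. The lower bound restricts to the
old tree a minimum dominating set of the new tree that contains all non-leaf supports
(`exists_isDominating_support_mem`), and checks that a vertex is saved whenever `A` grows.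

Conversely (`families_of_dominationNumber_eq`), by induction on the order, take a leaf `v₀` whose
support `v₁` has at most one non-leaf neighbour. If `v₁` has a second leaf, deleting `v₀` undoes
`O1`. If `v₁` has degree two, deleting `v₀` and `v₁` undoes `O3` or `O4`, according to the side of
`v₀`. Otherwise the tree is `K₂`. The wrong configurations are excluded by exchanging two vertices
of `A` for a common neighbour, which would give `γ < |A|` (`IsBipartition.dominationNumber_lt`).
`O2` is never needed in this direction. -/

lemma dominationNumber_le (D : Set V) (hf : D.Finite) (hD : IsDominating G D) :
    dominationNumber G ≤ D.ncard := by
  refine Nat.sInf_le ⟨hf.toFinset, by simpa using hD, ?_⟩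
  rw [Set.ncard_eq_toFinset_card D hf]

lemma exists_isDominating_ncard_eq [Finite V] (G : SimpleGraph V) :
    ∃ D : Set V, IsDominating G D ∧ D.ncard = dominationNumber G := by
  have hne : {n | ∃ D : Finset V, IsDominating G (D : Set V) ∧ D.card = n}.Nonempty := by
    cases nonempty_fintype V
    exact ⟨_, Finset.univ, fun v hv => absurd (by simp) hv, rfl⟩
  obtain ⟨D, hD, hc⟩ := Nat.sInf_mem hne
  exact ⟨D, hD, by rw [Set.ncard_coe_finset, hc]; rfl⟩

lemma not_isLeaf_of_adj {v x y : V} (hx : G.Adj v x) (hy : G.Adj v y) (h : x ≠ y) :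
    ¬ IsLeaf G v := fun hl => h (hl.unique hx hy)

/-- Some minimum dominating set contains every support that is not itself a leaf. -/
lemma exists_isDominating_support_mem [Finite V] (G : SimpleGraph V) :
    ∃ D : Set V, IsDominating G D ∧ D.ncard ≤ dominationNumber G ∧
      ∀ v, IsSupport G v → ¬ IsLeaf G v → v ∈ D := by
  classical
  obtain ⟨D, hD, hc⟩ := exists_isDominating_ncard_eq G
  -- The exchange map moves a leaf to its support when that support is not a leaf, and fixes every
  -- other vertex. In a `K₂` component both vertices are supports and leaves, which is why leaf
  -- supports are left out of the claim.
  have hφ : ∀ d, ∃ s, (s = d ∧ ∀ t, G.Adj d t → IsLeaf G d → IsLeaf G t) ∨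
      (G.Adj d s ∧ IsLeaf G d ∧ ¬ IsLeaf G s) := by
    intro d
    by_cases h : ∀ t, G.Adj d t → IsLeaf G d → IsLeaf G t
    · exact ⟨d, Or.inl ⟨rfl, h⟩⟩
    · push Not at h
      obtain ⟨t, h⟩ := h
      exact ⟨t, Or.inr h⟩
  choose φ hφ using hφ
  refine ⟨φ '' D, ?_, (Set.ncard_image_le (Set.toFinite D)).trans hc.le, ?_⟩
  · intro v hv
    by_cases hvD : v ∈ D
    · rcases hφ v with ⟨h, -⟩ | ⟨h, -⟩
      · exact absurd ⟨v, hvD, h⟩ hv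
      · exact ⟨φ v, ⟨v, hvD, rfl⟩, h⟩
    · obtain ⟨d, hd, hvd⟩ := hD v hvD
      rcases hφ d with ⟨h, -⟩ | ⟨h, hl, -⟩
      · exact ⟨d, ⟨d, hd, h⟩, hvd⟩
      · exact absurd ⟨d, hd, hl.unique h hvd.symm⟩ hv
  · rintro s ⟨l, hsl, hl⟩ hs
    by_cases hlD : l ∈ D
    · rcases hφ l with ⟨-, h⟩ | ⟨h, -, -⟩
      · exact absurd (h s hsl.symm hl) hs
      · exact ⟨l, hlD, hl.unique h hsl.symm⟩
    · obtain ⟨d, hd, hld⟩ := hD l hlD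
      obtain rfl := hl.unique hld hsl.symm
      rcases hφ d with ⟨h, -⟩ | ⟨-, h, -⟩
      · exact ⟨d, hd, h⟩
      · exact absurd h hs

lemma exists_adj [Nontrivial V] (hG : G.Connected) (v : V) : ∃ u, G.Adj v u :=
  hG.preconnected.exists_adj_of_nontrivial v

end Domination

/-! ### Bipartitions of connected graphs. -/

section Bipartition

variable {V : Type u} {G : SimpleGraph V} {A B : Set V}

lemma IsBipartition.mem_or (h : IsBipartition G A B) (v : V) : v ∈ A ∨ v ∈ B := by
  have : v ∈ A ∪ B := h.2 ▸ Set.mem_univ v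
  exact this

lemma IsBipartition.not_mem_right (h : IsBipartition G A B) {v : V} (hv : v ∈ A) : v ∉ B :=
  Set.disjoint_left.1 h.1.disjoint hv

lemma IsBipartition.symm (h : IsBipartition G A B) : IsBipartition G B A :=
  ⟨⟨h.1.disjoint.symm, fun _ _ hvw => (h.1.mem_of_adj hvw).symm⟩, by rw [Set.union_comm, h.2]⟩

lemma IsBipartition.mem_right (h : IsBipartition G A B) {v w : V} (hvw : G.Adj v w)
    (hv : v ∈ A) : w ∈ B := by
  rcases h.1.mem_of_adj hvw with h' | h'
  · exact h'.2
  · exact absurd h'.1 (h.not_mem_right hv)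

lemma IsBipartition.mem_left (h : IsBipartition G A B) {v w : V} (hvw : G.Adj v w)
    (hv : v ∈ B) : w ∈ A := h.symm.mem_right hvw hv

lemma IsBipartition.isDominating [Nontrivial V] (h : IsBipartition G A B) (hG : G.Connected) :
    IsDominating G A := fun v hv => by
  obtain ⟨u, hu⟩ := exists_adj hG v
  exact ⟨u, h.mem_left hu ((h.mem_or v).resolve_left hv), hu⟩

lemma IsBipartition.dominationNumber_le [Finite V] [Nontrivial V] (h : IsBipartition G A B)
    (hG : G.Connected) : dominationNumber G ≤ A.ncard :=
  TreeDom.dominationNumber_le A (Set.toFinite A) (h.isDominating hG)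

/-- Agreement of two bipartitions at one vertex propagates along walks, so the side of a single
vertex `r` decides everything. -/
lemma IsBipartition.eq_or_swap {A' B' : Set V} (h : IsBipartition G A B)
    (h' : IsBipartition G A' B') (hG : G.Connected) :
    (A = A' ∧ B = B') ∨ (A = B' ∧ B = A') := by
  have key : ∀ {A B A' B' : Set V}, IsBipartition G A B → IsBipartition G A' B' →
      ∀ r ∈ A, r ∈ A' → A ⊆ A' ∧ B ⊆ B' := by
    intro A B A' B' h h' r hr hr'
    have : ∀ v, (v ∈ A ∧ v ∈ A') ∨ (v ∈ B ∧ v ∈ B') := by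
      intro v
      obtain ⟨p⟩ := hG.preconnected r v
      have walk : ∀ {x y : V} (p : G.Walk x y), ((x ∈ A ∧ x ∈ A') ∨ (x ∈ B ∧ x ∈ B')) →
          ((y ∈ A ∧ y ∈ A') ∨ (y ∈ B ∧ y ∈ B')) := by
        intro x y p
        induction p with
        | nil => exact id
        | cons hadj _ ih =>
          rintro (⟨h1, h2⟩ | ⟨h1, h2⟩)
          · exact ih (Or.inr ⟨h.mem_right hadj h1, h'.mem_right hadj h2⟩)
          · exact ih (Or.inl ⟨h.mem_left hadj h1, h'.mem_left hadj h2⟩)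
      exact walk p (Or.inl ⟨hr, hr'⟩)
    constructor
    · intro v hv
      rcases this v with h1 | h1
      · exact h1.2
      · exact absurd h1.1 (h.not_mem_right hv)
    · intro v hv
      rcases this v with h1 | h1
      · exact absurd hv (h.not_mem_right h1.1)
      · exact h1.2
  obtain ⟨r⟩ := hG.nonempty
  rcases h.mem_or r with h1 | h1 <;> rcases h'.mem_or r with h2 | h2
  · have a := key h h' r h1 h2
    have b := key h' h r h2 h1
    exact Or.inl ⟨a.1.antisymm b.1, a.2.antisymm b.2⟩
  · have a := key h h'.symm r h1 h2
    have b := key h'.symm h r h2 h1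
    exact Or.inr ⟨a.1.antisymm b.1, a.2.antisymm b.2⟩
  · have a := key h.symm h' r h1 h2
    have b := key h' h.symm r h2 h1
    exact Or.inr ⟨a.2.antisymm b.2, a.1.antisymm b.1⟩
  · have a := key h.symm h'.symm r h1 h2
    have b := key h'.symm h.symm r h2 h1
    exact Or.inl ⟨a.2.antisymm b.2, a.1.antisymm b.1⟩

end Bipartition

/-! ### Leaves far from a root. -/

section Tree

variable {V : Type u} {T : SimpleGraph V}

/-- A vertex of a tree has at most one neighbour that is closer to the root. -/
lemma eq_of_adj_of_dist_lt (hT : T.IsTree) {r v x y : V} (hx : T.Adj v x) (hy : T.Adj v y)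
    (hdx : T.dist r x < T.dist r v) (hdy : T.dist r y < T.dist r v) : x = y := by
  -- A geodesic from a closer neighbour, preceded by the edge from `v`, is again a geodesic and
  -- hence a path. Paths from `v` to `r` are unique, so their second vertices agree.
  have key : ∀ z, T.Adj v z → T.dist r z < T.dist r v →
      ∃ (h : T.Adj v z) (p : T.Walk z r), (SimpleGraph.Walk.cons h p).IsPath := by
    intro z hz hd
    obtain ⟨p, hp⟩ := hT.connected.exists_walk_length_eq_dist z r
    refine ⟨hz, p, SimpleGraph.Walk.isPath_of_length_eq_dist _ ?_⟩
    have := SimpleGraph.dist_le (SimpleGraph.Walk.cons hz p)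
    have e₁ := T.dist_comm (u := z) (v := r)
    have e₂ := T.dist_comm (u := v) (v := r)
    simp only [SimpleGraph.Walk.length_cons] at this ⊢
    omega
  obtain ⟨h1, p, hp⟩ := key x hx hdx
  obtain ⟨h2, q, hq⟩ := key y hy hdy
  have := congrArg Subtype.val ((hT.isAcyclic.subsingleton_path v r).elim ⟨_, hp⟩ ⟨_, hq⟩)
  simp only [SimpleGraph.Walk.cons.injEq] at this
  exact this.1

/-- A nontrivial finite tree has a leaf whose support has at most one neighbour that is not a
leaf. -/
lemma exists_leaf_of_isTree [Finite V] [Nontrivial V] (hT : T.IsTree) :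
    ∃ v₀ v₁, T.Adj v₁ v₀ ∧ IsLeaf T v₀ ∧
      ∀ x y, T.Adj v₁ x → T.Adj v₁ y → ¬ IsLeaf T x → ¬ IsLeaf T y → x = y := by
  obtain ⟨r⟩ := hT.connected.nonempty
  -- Every vertex at maximal distance from `r` is a leaf. The support of `v₀` lies one level below
  -- the maximum, so its non-leaf neighbours are closer to `r` than it is, and there is at most one
  -- of those.
  obtain ⟨v₀, hmax⟩ := Finite.exists_max fun v => T.dist r v
  have hlt : ∀ v w, T.Adj v w → T.dist r v = T.dist r v₀ → T.dist r w < T.dist r v := by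
    intro v w hvw hv
    have h1 := hT.dist_ne_of_adj r hvw
    have h3 := hvw.diff_dist_adj (u := r)
    have h2 := hmax w
    omega
  have hleaf : ∀ v, T.dist r v = T.dist r v₀ → IsLeaf T v := by
    intro v hv
    obtain ⟨u, hu⟩ := exists_adj hT.connected v
    exact ⟨u, hu, fun w hw =>
      eq_of_adj_of_dist_lt hT hw hu (hlt v w hw hv) (hlt v u hu hv)⟩
  obtain ⟨v₁, h₁⟩ := exists_adj hT.connected v₀
  refine ⟨v₀, v₁, h₁.symm, hleaf v₀ rfl, ?_⟩
  have hcl : ∀ z, T.Adj v₁ z → ¬ IsLeaf T z → T.dist r z < T.dist r v₁ := by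
    intro z hz hzl
    have h0 : T.dist r z ≠ T.dist r v₀ := fun h => hzl (hleaf z h)
    have h1 := hT.dist_ne_of_adj r hz
    have h2 := hT.dist_ne_of_adj r h₁
    have h3 := hmax z
    have h4 := hmax v₁
    have h5 := h₁.diff_dist_adj (u := r)
    omega
  exact fun x y hx hy hxl hyl => eq_of_adj_of_dist_lt hT hx hy (hcl x hx hxl) (hcl y hy hyl)

end Tree

/-! ### Attaching a vertex or a path: connectedness and bipartitions. -/

section Attach

variable {V W : Type u} {T' : SimpleGraph W} {T : SimpleGraph V} {f : T' ↪g T} {p : W} {x y : V}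
  {A' B' : Set W} {A B : Set V}

lemma AttachVertex.eq_or (h : AttachVertex f p x) (v : V) : v = x ∨ ∃ w, f w = v := by
  by_cases hv : v = x
  · exact Or.inl hv
  · exact Or.inr (h.1.ge hv)

lemma AttachVertex.ne (h : AttachVertex f p x) (w : W) : f w ≠ x :=
  h.1.le ⟨w, rfl⟩

lemma AttachVertex.adj (h : AttachVertex f p x) : T.Adj x (f p) := (h.2 _).2 rfl

lemma AttachVertex.isLeaf (h : AttachVertex f p x) : IsLeaf T x :=
  ⟨f p, h.adj, fun z hz => (h.2 z).1 hz⟩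

lemma AttachPath.eq_or (h : AttachPath f p x y) (v : V) : v = x ∨ v = y ∨ ∃ w, f w = v := by
  by_cases hx : v = x
  · exact Or.inl hx
  · by_cases hy : v = y
    · exact Or.inr (Or.inl hy)
    · exact Or.inr (Or.inr (h.2.1.ge (by simp [hx, hy])))

lemma AttachPath.ne_left (h : AttachPath f p x y) (w : W) : f w ≠ x := fun hw => by
  simpa [hw] using h.2.1.le ⟨w, rfl⟩

lemma AttachPath.ne_right (h : AttachPath f p x y) (w : W) : f w ≠ y := fun hw => by
  simpa [hw] using h.2.1.le ⟨w, rfl⟩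

lemma AttachPath.adj (h : AttachPath f p x y) : T.Adj x (f p) := (h.2.2.1 _).2 (Or.inr rfl)

lemma AttachPath.adj_end (h : AttachPath f p x y) : T.Adj x y := (h.2.2.1 _).2 (Or.inl rfl)

lemma AttachPath.isLeaf (h : AttachPath f p x y) : IsLeaf T y :=
  ⟨x, h.adj_end.symm, fun z hz => (h.2.2.2 z).1 hz⟩

lemma connected_of_embedding (f : T' ↪g T) (hT' : T'.Connected)
    (h : ∀ v, ∃ w, T.Reachable v (f w)) : T.Connected := by
  obtain ⟨w₀⟩ := hT'.nonempty
  have : Nonempty V := ⟨f w₀⟩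
  refine ⟨fun u v => ?_⟩
  obtain ⟨a, ha⟩ := h u
  obtain ⟨b, hb⟩ := h v
  exact ha.trans (((hT'.preconnected a b).map f.toHom).trans hb.symm)

lemma AttachVertex.connected (h : AttachVertex f p x) (hT' : T'.Connected) : T.Connected :=
  connected_of_embedding f hT' fun v => by
    rcases h.eq_or v with rfl | ⟨w, rfl⟩
    · exact ⟨p, h.adj.reachable⟩
    · exact ⟨w, SimpleGraph.Reachable.refl _⟩

lemma AttachPath.connected (h : AttachPath f p x y) (hT' : T'.Connected) : T.Connected :=
  connected_of_embedding f hT' fun v => by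
    rcases h.eq_or v with rfl | rfl | ⟨w, rfl⟩
    · exact ⟨p, h.adj.reachable⟩
    · exact ⟨p, h.adj_end.symm.reachable.trans h.adj.reachable⟩
    · exact ⟨w, SimpleGraph.Reachable.refl _⟩

lemma isBipartition_of_forall (h : ∀ v, (v ∈ A ∧ v ∉ B) ∨ (v ∈ B ∧ v ∉ A))
    (hadj : ∀ v w, T.Adj v w → (v ∈ A ↔ w ∈ B)) : IsBipartition T A B := by
  refine ⟨⟨Set.disjoint_left.2 fun v hA hB => ?_, fun v w hvw => ?_⟩,
    Set.eq_univ_of_forall fun v => ?_⟩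
  · have := h v
    tauto
  · have := h v
    have := h w
    have := hadj v w hvw
    tauto
  · have := h v
    simp only [Set.mem_union]
    tauto

lemma AttachVertex.isBipartition (h : AttachVertex f p x) (hAB : IsBipartition T' A' B')
    (hp : p ∈ A') : IsBipartition T (f '' A') (insert x (f '' B')) := by
  have hA : ∀ w, f w ∈ f '' A' ↔ w ∈ A' := fun w => f.injective.mem_set_image
  have hB : ∀ w, f w ∈ insert x (f '' B') ↔ w ∈ B' := fun w => by
    rw [Set.mem_insert_iff, f.injective.mem_set_image, or_iff_right (h.ne w)]
  have hxA : x ∉ f '' A' := fun ⟨w, _, hw⟩ => h.ne w hw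
  have hxB : x ∈ insert x (f '' B') := Set.mem_insert _ _
  have hpB := hAB.not_mem_right hp
  refine isBipartition_of_forall (fun v => ?_) fun v w hvw => ?_
  · rcases h.eq_or v with rfl | ⟨w, rfl⟩
    · exact Or.inr ⟨hxB, hxA⟩
    · have := hAB.mem_or w
      have := @IsBipartition.not_mem_right _ _ _ _ hAB w
      rw [hA, hB]
      tauto
  · rcases h.eq_or v with rfl | ⟨v, rfl⟩
    · rw [h.2] at hvw
      subst hvw
      rw [hB]
      tauto
    · rcases h.eq_or w with rfl | ⟨w, rfl⟩
      · rw [T.adj_comm, h.2] at hvw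
        rw [hvw, hA]
        tauto
      · rw [f.map_adj_iff] at hvw
        rw [hA, hB]
        exact ⟨hAB.mem_right hvw, hAB.mem_left hvw.symm⟩

lemma AttachPath.isBipartition (h : AttachPath f p x y) (hAB : IsBipartition T' A' B')
    (hp : p ∈ A') : IsBipartition T (insert y (f '' A')) (insert x (f '' B')) := by
  have hA : ∀ w, f w ∈ insert y (f '' A') ↔ w ∈ A' := fun w => by
    rw [Set.mem_insert_iff, f.injective.mem_set_image, or_iff_right (h.ne_right w)]
  have hB : ∀ w, f w ∈ insert x (f '' B') ↔ w ∈ B' := fun w => by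
    rw [Set.mem_insert_iff, f.injective.mem_set_image, or_iff_right (h.ne_left w)]
  have hxA : x ∉ insert y (f '' A') := by
    rintro (hxy | ⟨w, _, hw⟩)
    exacts [h.1 hxy, h.ne_left w hw]
  have hyB : y ∉ insert x (f '' B') := by
    rintro (hxy | ⟨w, _, hw⟩)
    exacts [h.1 hxy.symm, h.ne_right w hw]
  have hxB : x ∈ insert x (f '' B') := Set.mem_insert _ _
  have hyA : y ∈ insert y (f '' A') := Set.mem_insert _ _
  have hpB := hAB.not_mem_right hp
  refine isBipartition_of_forall (fun v => ?_) fun v w hvw => ?_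
  · rcases h.eq_or v with rfl | rfl | ⟨w, rfl⟩
    · exact Or.inr ⟨hxB, hxA⟩
    · exact Or.inl ⟨hyA, hyB⟩
    · have := hAB.mem_or w
      have := @IsBipartition.not_mem_right _ _ _ _ hAB w
      rw [hA, hB]
      tauto
  · rcases h.eq_or v with rfl | rfl | ⟨v, rfl⟩
    · rw [h.2.2.1] at hvw
      rcases hvw with rfl | rfl
      · tauto
      · rw [hB]
        tauto
    · rw [h.2.2.2] at hvw
      subst hvw
      tauto
    · rcases h.eq_or w with rfl | rfl | ⟨w, rfl⟩
      · rw [T.adj_comm, h.2.2.1, or_iff_right (h.ne_right v)] at hvw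
        rw [hvw, hA]
        tauto
      · rw [T.adj_comm, h.2.2.2] at hvw
        exact absurd hvw (h.ne_left v)
      · rw [f.map_adj_iff] at hvw
        rw [hA, hB]
        exact ⟨hAB.mem_right hvw, hAB.mem_left hvw.symm⟩

lemma Operation.exists_isBipartition (h : Operation f A' B') (hAB : IsBipartition T' A' B') :
    ∃ A B, IsBipartition T A B ∧ f '' A' ⊆ A ∧ f '' B' ⊆ B := by
  cases h with
  | O1 a' ha' b h => exact ⟨_, _, h.isBipartition hAB ha', subset_rfl, Set.subset_insert _ _⟩
  | O2 b' hb' _ _ a h =>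
    exact ⟨_, _, (h.isBipartition hAB.symm hb').symm, Set.subset_insert _ _, subset_rfl⟩
  | O3 a' ha' _ a b h =>
    exact ⟨_, _, h.isBipartition hAB ha', Set.subset_insert _ _, Set.subset_insert _ _⟩
  | O4 b' hb' _ a b h =>
    exact ⟨_, _, (h.isBipartition hAB.symm hb').symm, Set.subset_insert _ _, Set.subset_insert _ _⟩

lemma Operation.connected (h : Operation f A' B') (hT' : T'.Connected) : T.Connected := by
  cases h with
  | O1 _ _ _ h => exact h.connected hT'
  | O2 _ _ _ _ _ h => exact h.connected hT'
  | O3 _ _ _ _ _ h => exact h.connected hT'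
  | O4 _ _ _ _ _ h => exact h.connected hT'

lemma Operation.finite [Finite W] (h : Operation f A' B') : Finite V := by
  have key : ∀ s : Set V, s.Finite → Set.range f = sᶜ → Finite V := fun s hs hf => by
    refine Set.finite_univ_iff.1 ?_
    rw [← Set.union_compl_self s, ← hf]
    exact hs.union (Set.finite_range f)
  cases h with
  | O1 _ _ _ h => exact key _ (Set.toFinite _) h.1
  | O2 _ _ _ _ _ h => exact key _ (Set.toFinite _) h.1
  | O3 _ _ _ _ _ h => exact key _ (Set.toFinite _) h.2.1
  | O4 _ _ _ _ _ h => exact key _ (Set.toFinite _) h.2.1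

/-! ### Lower bound on the domination number after an operation. -/

lemma ncard_preimage_le [Finite V] (f : T' ↪g T) (D : Set V) : (f ⁻¹' D).ncard ≤ D.ncard := by
  rw [← Set.ncard_image_of_injective _ f.injective]
  exact Set.ncard_le_ncard (Set.image_preimage_subset _ _) (Set.toFinite D)

lemma ncard_preimage_lt [Finite V] (f : T' ↪g T) {D : Set V} {x : V} (hx : x ∈ D)
    (hf : ∀ w, f w ≠ x) : (f ⁻¹' D).ncard < D.ncard := by
  rw [← Set.ncard_image_of_injective _ f.injective]
  refine Set.ncard_lt_ncard ⟨Set.image_preimage_subset _ _, fun h => ?_⟩ (Set.toFinite D)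
  obtain ⟨w, -, hw⟩ := h hx
  exact hf w hw

lemma isLeaf_map {l : W} (hl : IsLeaf T' l) (h : ∀ z, T.Adj (f l) z → ∃ w, f w = z) :
    IsLeaf T (f l) := by
  obtain ⟨u, hu, huniq⟩ := hl
  refine ⟨f u, f.map_adj_iff.2 hu, fun z hz => ?_⟩
  obtain ⟨w, rfl⟩ := h z hz
  rw [huniq w (f.map_adj_iff.1 hz)]

lemma AttachVertex.isLeaf_map (h : AttachVertex f p x) {l : W} (hl : IsLeaf T' l) (hlp : l ≠ p) :
    IsLeaf T (f l) :=
  TreeDom.isLeaf_map hl fun z hz => by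
    rcases h.eq_or z with rfl | hz'
    · exact absurd (f.injective ((h.2 _).1 hz.symm)) hlp
    · exact hz'

lemma AttachPath.isLeaf_map (h : AttachPath f p x y) {l : W} (hl : IsLeaf T' l) (hlp : l ≠ p) :
    IsLeaf T (f l) :=
  TreeDom.isLeaf_map hl fun z hz => by
    rcases h.eq_or z with rfl | rfl | hz'
    · rcases (h.2.2.1 _).1 hz.symm with hl' | hl'
      · exact absurd hl' (h.ne_right l)
      · exact absurd (f.injective hl') hlp
    · exact absurd ((h.2.2.2 _).1 hz.symm) (h.ne_left l)
    · exact hz'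

/-- The domination number grows by at least the number of vertices added to the first partite
set. -/
lemma Operation.add_ncard_le [Finite V] [Finite W] [Nontrivial W] (h : Operation f A' B')
    (hT' : T'.Connected) (hAB' : IsBipartition T' A' B') (hAB : IsBipartition T A B)
    (hA : f '' A' ⊆ A) (hB : f '' B' ⊆ B) :
    dominationNumber T' + A.ncard ≤ dominationNumber T + A'.ncard := by
  have hmemA : ∀ {w}, w ∈ A' → f w ∈ A := fun hw => hA ⟨_, hw, rfl⟩
  have hmemB : ∀ {w}, w ∈ B' → f w ∈ B := fun hw => hB ⟨_, hw, rfl⟩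
  have hback : ∀ {w}, f w ∈ A → f w ∈ f '' A' := fun {w} hw =>
    ⟨w, (hAB'.mem_or w).resolve_right fun hw' => hAB.not_mem_right hw (hmemB hw'), rfl⟩
  have hcard := Set.ncard_image_of_injective A' f.injective
  have hinsert : ∀ a, A ⊆ insert a (f '' A') → A.ncard ≤ A'.ncard + 1 := fun a ha => by
    rw [← hcard]
    exact (Set.ncard_le_ncard ha (Set.toFinite _)).trans (Set.ncard_insert_le _ _)
  obtain ⟨D, hD, hDc, hS⟩ := exists_isDominating_support_mem T
  cases h with
  | O1 a' ha' b h =>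
    have hAc : A.ncard ≤ A'.ncard := by
      rw [← hcard]
      refine Set.ncard_le_ncard (fun v hv => ?_) (Set.toFinite _)
      rcases h.eq_or v with rfl | ⟨w, rfl⟩
      · exact absurd (hAB.mem_right h.adj.symm (hmemA ha')) (hAB.not_mem_right hv)
      · exact hback hv
    obtain ⟨u, hu⟩ := exists_adj hT' a'
    -- The only old vertex that `b` could dominate is `a'`, which is itself in `D`, so restricting
    -- `D` loses nothing.
    have haD : f a' ∈ D := hS _ ⟨b, h.adj.symm, h.isLeaf⟩
      (not_isLeaf_of_adj h.adj.symm (f.map_adj_iff.2 hu) (h.ne u).symm)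
    have hdom : IsDominating T' (f ⁻¹' D) := fun v hv => by
      obtain ⟨d, hd, hvd⟩ := hD (f v) hv
      rcases h.eq_or d with rfl | ⟨w, rfl⟩
      · have := f.injective ((h.2 _).1 hvd.symm)
        exact absurd (this ▸ haD) hv
      · exact ⟨w, hd, f.map_adj_iff.1 hvd⟩
    have := dominationNumber_le _ (Set.toFinite _) hdom
    have := ncard_preimage_le f D
    omega
  | O2 b' hb' hN hL a h =>
    have hAc := hinsert a fun v hv => by
      rcases h.eq_or v with rfl | ⟨w, rfl⟩
      · exact Set.mem_insert _ _
      · exact Set.mem_insert_of_mem _ (hback hv)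
    obtain ⟨u, hu⟩ := exists_adj hT' b'
    have hbD : f b' ∈ D := hS _ ⟨a, h.adj.symm, h.isLeaf⟩
      (not_isLeaf_of_adj h.adj.symm (f.map_adj_iff.2 hu) (h.ne u).symm)
    -- Since `b'` is not a leaf, the leaf at each neighbour `u` survives in `T`, so `u` is a
    -- non-leaf support and lies in `D`. Thus `b'` is dominated by `u` and dominates nobody who
    -- needs it: it can be dropped from the restriction, which is the vertex saved.
    have huD : ∀ u, T'.Adj b' u → f u ∈ D := fun u hu => by
      obtain ⟨l, hul, hl⟩ := hN u hu
      have hlb : l ≠ b' := fun hlb => hL (hlb ▸ hl)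
      exact hS _ ⟨f l, f.map_adj_iff.2 hul, h.isLeaf_map hl hlb⟩
        (not_isLeaf_of_adj (f.map_adj_iff.2 hul) (f.map_adj_iff.2 hu.symm) (f.injective.ne hlb))
    have hdom : IsDominating T' (f ⁻¹' D \ {b'}) := fun v hv => by
      by_cases hvb : v = b'
      · subst hvb
        exact ⟨u, ⟨huD u hu, hu.ne'⟩, hu⟩
      · have hv' : f v ∉ D := fun hv' => hv ⟨hv', hvb⟩
        obtain ⟨d, hd, hvd⟩ := hD (f v) hv'
        rcases h.eq_or d with rfl | ⟨w, rfl⟩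
        · exact absurd (f.injective ((h.2 _).1 hvd.symm)) hvb
        · by_cases hwb : w = b'
          · subst hwb
            exact absurd (huD v (f.map_adj_iff.1 hvd.symm)) hv'
          · exact ⟨w, ⟨hd, hwb⟩, f.map_adj_iff.1 hvd⟩
    have := dominationNumber_le _ (Set.toFinite _) hdom
    have := ncard_preimage_le f D
    have := Set.ncard_sdiff_singleton_lt_of_mem (s := f ⁻¹' D) hbD (Set.toFinite _)
    omega
  | O3 a' ha' hSup a b h =>
    have hAc := hinsert a fun v hv => by
      rcases h.eq_or v with rfl | rfl | ⟨w, rfl⟩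
      · exact absurd (hAB.mem_right h.adj.symm (hmemA ha')) (hAB.not_mem_right hv)
      · exact Set.mem_insert _ _
      · exact Set.mem_insert_of_mem _ (hback hv)
    -- Both `b` and `f a'` are non-leaf supports of `T`. Restriction drops `b`, and `a'` does not
    -- miss it.
    have hbD : b ∈ D := hS _ ⟨a, h.adj_end, h.isLeaf⟩
      (not_isLeaf_of_adj h.adj h.adj_end (h.ne_right _))
    have haD : f a' ∈ D := by
      obtain ⟨l, hul, hl⟩ := hSup
      exact hS _ ⟨f l, f.map_adj_iff.2 hul, h.isLeaf_map hl hul.ne'⟩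
        (not_isLeaf_of_adj (f.map_adj_iff.2 hul) h.adj.symm (h.ne_left l))
    have hdom : IsDominating T' (f ⁻¹' D) := fun v hv => by
      obtain ⟨d, hd, hvd⟩ := hD (f v) hv
      rcases h.eq_or d with rfl | rfl | ⟨w, rfl⟩
      · rcases (h.2.2.1 _).1 hvd.symm with hv' | hv'
        · exact absurd hv' (h.ne_right v)
        · exact absurd (f.injective hv' ▸ haD) hv
      · exact absurd ((h.2.2.2 _).1 hvd.symm) (h.ne_left v)
      · exact ⟨w, hd, f.map_adj_iff.1 hvd⟩
    have := dominationNumber_le _ (Set.toFinite _) hdom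
    have := ncard_preimage_lt f hbD h.ne_left
    omega
  | O4 b' hb' hcrit a b h =>
    have hAc := hinsert a fun v hv => by
      rcases h.eq_or v with rfl | rfl | ⟨w, rfl⟩
      · exact Set.mem_insert _ _
      · exact absurd (hAB.mem_right h.adj_end (hAB.mem_left h.adj.symm (hmemB hb')))
          (hAB.not_mem_right hv)
      · exact Set.mem_insert_of_mem _ (hback hv)
    -- Domination of the leaf `b` puts `a` or `b` into `D`, and restriction loses that vertex.
    have hDlt : (f ⁻¹' D).ncard < D.ncard := by
      by_cases haD : a ∈ D
      · exact ncard_preimage_lt f haD h.ne_left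
      · refine ncard_preimage_lt f (x := b) ?_ h.ne_right
        by_contra hbD
        obtain ⟨d, hd, hbd⟩ := hD b hbD
        exact haD ((h.2.2.2 d).1 hbd ▸ hd)
    have hdom : ∀ v, v ≠ b' → v ∉ f ⁻¹' D → ∃ w ∈ f ⁻¹' D, T'.Adj v w := fun v hvb hv => by
      obtain ⟨d, hd, hvd⟩ := hD (f v) hv
      rcases h.eq_or d with rfl | rfl | ⟨w, rfl⟩
      · rcases (h.2.2.1 _).1 hvd.symm with hv' | hv'
        · exact absurd hv' (h.ne_right v)
        · exact absurd (f.injective hv') hvb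
      · exact absurd ((h.2.2.2 _).1 hvd.symm) (h.ne_left v)
      · exact ⟨w, hd, f.map_adj_iff.1 hvd⟩
    -- Only `b'` may have relied on `a`. If `b'` is outside the restriction, the restriction still
    -- dominates `T' - b'`, and non-criticality gives `γ(T') ≤ γ(T' - b')`.
    by_cases hb : b' ∉ f ⁻¹' D
    · have hdom' : IsDominating (T'.induce ({b'}ᶜ : Set W)) (Subtype.val ⁻¹' (f ⁻¹' D)) := by
        rintro ⟨v, hvb⟩ hv
        obtain ⟨w, hw, hvw⟩ := hdom v hvb hv
        exact ⟨⟨w, fun hwb => hb (hwb ▸ hw)⟩, hw, hvw⟩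
      have := dominationNumber_le _ (Set.toFinite _) hdom'
      have : (Subtype.val ⁻¹' (f ⁻¹' D) : Set ({b'}ᶜ : Set W)).ncard ≤ (f ⁻¹' D).ncard :=
        ncard_preimage_le (SimpleGraph.Embedding.induce (G := T') ({b'}ᶜ)) (f ⁻¹' D)
      have := not_lt.1 hcrit
      omega
    · have hdom' : IsDominating T' (f ⁻¹' D) := fun v hv => hdom v (fun h => hb (h ▸ hv)) hv
      have := dominationNumber_le _ (Set.toFinite _) hdom'
      omega

end Attach

/-! ### Undoing an operation: smaller trees and upper bounds. -/

section Reduction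

variable {V W : Type u} {T' : SimpleGraph W} {T : SimpleGraph V} {f : T' ↪g T} {p : W} {x y : V}
  {A B : Set V}

/-- Walks of `T` project to `T'`. It is applied to the retraction that collapses the attached
vertices onto `p`. -/
lemma connected_of_retraction [Nonempty W] (hT : T.Connected) (r : V → W)
    (hr : ∀ w, r (f w) = w) (hadj : ∀ u v, T.Adj u v → T'.Reachable (r u) (r v)) :
    T'.Connected := by
  refine ⟨fun a b => ?_⟩
  have key : ∀ {u v : V} (_ : T.Walk u v), T'.Reachable (r u) (r v) := by
    intro u v q
    induction q with
    | nil => exact SimpleGraph.Reachable.refl _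
    | cons h _ ih => exact (hadj _ _ h).trans ih
  obtain ⟨q⟩ := hT.preconnected (f a) (f b)
  simpa only [hr] using key q

lemma AttachVertex.isTree (h : AttachVertex f p x) (hT : T.IsTree) : T'.IsTree := by
  have : Nonempty W := ⟨p⟩
  have hr : ∀ w, Function.extend f id (fun _ => p) (f w) = w := fun w =>
    f.injective.extend_apply _ _ w
  have hx : Function.extend f id (fun _ => p) x = p :=
    Function.extend_apply' _ _ _ fun ⟨w, hw⟩ => h.ne w hw
  refine ⟨connected_of_retraction hT.connected (Function.extend f id fun _ => p) hr
    fun u v huv => ?_, hT.isAcyclic.embedding f⟩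
  rcases h.eq_or u with rfl | ⟨u, rfl⟩
  · rw [(h.2 _).1 huv, hx, hr]
  · rcases h.eq_or v with rfl | ⟨v, rfl⟩
    · rw [(h.2 _).1 huv.symm, hx, hr]
    · rw [hr, hr]
      exact (f.map_adj_iff.1 huv).reachable

lemma AttachPath.isTree (h : AttachPath f p x y) (hT : T.IsTree) : T'.IsTree := by
  have : Nonempty W := ⟨p⟩
  have hr : ∀ w, Function.extend f id (fun _ => p) (f w) = w := fun w =>
    f.injective.extend_apply _ _ w
  have hx : Function.extend f id (fun _ => p) x = p :=
    Function.extend_apply' _ _ _ fun ⟨w, hw⟩ => h.ne_left w hw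
  have hy : Function.extend f id (fun _ => p) y = p :=
    Function.extend_apply' _ _ _ fun ⟨w, hw⟩ => h.ne_right w hw
  have key : ∀ v, T.Adj x v → Function.extend f id (fun _ => p) v = p := fun v hv => by
    rcases (h.2.2.1 _).1 hv with rfl | rfl
    exacts [hy, hr p]
  refine ⟨connected_of_retraction hT.connected (Function.extend f id fun _ => p) hr
    fun u v huv => ?_, hT.isAcyclic.embedding f⟩
  rcases h.eq_or u with rfl | rfl | ⟨u, rfl⟩
  · rw [hx, key _ huv]
  · rw [(h.2.2.2 _).1 huv, hx, hy]
  · rcases h.eq_or v with rfl | rfl | ⟨v, rfl⟩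
    · rw [hx, key _ huv.symm]
    · rw [(h.2.2.2 _).1 huv.symm, hx, hy]
    · rw [hr, hr]
      exact (f.map_adj_iff.1 huv).reachable

lemma IsBipartition.preimage (h : IsBipartition T A B) (f : T' ↪g T) :
    IsBipartition T' (f ⁻¹' A) (f ⁻¹' B) :=
  ⟨⟨h.1.disjoint.preimage f, fun _ _ hvw => h.1.mem_of_adj (f.map_adj_iff.2 hvw)⟩,
    Set.eq_univ_of_forall fun v => h.mem_or (f v)⟩

/-- A dominating set of `T'` must contain `p` or its other leaf `l`. Exchanging `l` for `p` when
necessary makes it dominate the new leaf at no cost. -/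
lemma AttachVertex.dominationNumber_le [Finite V] (h : AttachVertex f p x) {l : V}
    (hl : IsLeaf T l) (hpl : T.Adj (f p) l) (hlx : l ≠ x) :
    dominationNumber T ≤ dominationNumber T' := by
  have : Finite W := Finite.of_injective f f.injective
  obtain ⟨D, hD, hDc⟩ := exists_isDominating_ncard_eq T'
  rw [← hDc, ← Set.ncard_image_of_injective D f.injective]
  have hadj : ∀ v, v ≠ x → v ∉ f '' D → ∃ d ∈ f '' D, T.Adj v d := fun v hvx hv => by
    obtain ⟨w, rfl⟩ := (h.eq_or v).resolve_left hvx
    obtain ⟨d, hd, hwd⟩ := hD w fun hw => hv ⟨w, hw, rfl⟩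
    exact ⟨f d, ⟨d, hd, rfl⟩, f.map_adj_iff.2 hwd⟩
  by_cases hp : f p ∈ f '' D
  · refine TreeDom.dominationNumber_le _ (Set.toFinite _) fun v hv => ?_
    by_cases hvx : v = x
    · exact ⟨f p, hp, hvx ▸ h.adj⟩
    · exact hadj v hvx hv
  · have hlD : l ∈ f '' D := by
      by_contra hlD
      obtain ⟨d, hd, hld⟩ := hadj l hlx hlD
      exact hp (hl.unique hld hpl.symm ▸ hd)
    have hdom : IsDominating T (insert (f p) (f '' D \ {l})) := fun v hv => by
      by_cases hvx : v = x
      · exact ⟨f p, Set.mem_insert _ _, hvx ▸ h.adj⟩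
      by_cases hvl : v = l
      · exact ⟨f p, Set.mem_insert _ _, hvl ▸ hpl.symm⟩
      · obtain ⟨d, hd, hvd⟩ := hadj v hvx fun hv' => hv (Or.inr ⟨hv', hvl⟩)
        refine ⟨d, Or.inr ⟨hd, fun hdl => hv (Or.inl ?_)⟩, hvd⟩
        rw [Set.mem_singleton_iff] at hdl
        subst hdl
        exact hl.unique hvd.symm hpl.symm
    have h1 := TreeDom.dominationNumber_le _ (Set.toFinite _) hdom
    have h2 := Set.ncard_insert_le (f p) (f '' D \ {l})
    have h3 := Set.ncard_sdiff_singleton_lt_of_mem hlD (Set.toFinite _)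
    omega

/-- The single extra vertex `x` takes care of `x`, `y` and `p`, so `D` need not dominate `p`. This
allows `D` to come either from `T'` or from `T' - p`. -/
lemma AttachPath.dominationNumber_le_of_dominates [Finite V] (h : AttachPath f p x y) {D : Set W}
    (hD : ∀ v, v ≠ p → v ∉ D → ∃ d ∈ D, T'.Adj v d) : dominationNumber T ≤ D.ncard + 1 := by
  have : Finite W := Finite.of_injective f f.injective
  rw [← Set.ncard_image_of_injective D f.injective]
  refine (TreeDom.dominationNumber_le (insert x (f '' D)) (Set.toFinite _) fun v hv => ?_).trans
    (Set.ncard_insert_le _ _)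
  rcases h.eq_or v with rfl | rfl | ⟨w, rfl⟩
  · exact absurd (Set.mem_insert _ _) hv
  · exact ⟨x, Set.mem_insert _ _, h.adj_end.symm⟩
  · by_cases hw : w = p
    · exact ⟨x, Set.mem_insert _ _, hw ▸ h.adj.symm⟩
    · obtain ⟨d, hd, hwd⟩ := hD w hw fun hw' => hv (Or.inr ⟨w, hw', rfl⟩)
      exact ⟨f d, Or.inr ⟨d, hd, rfl⟩, f.map_adj_iff.2 hwd⟩

lemma AttachPath.dominationNumber_le [Finite V] (h : AttachPath f p x y) :
    dominationNumber T ≤ dominationNumber T' + 1 := by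
  have : Finite W := Finite.of_injective f f.injective
  obtain ⟨D, hD, hDc⟩ := exists_isDominating_ncard_eq T'
  rw [← hDc]
  exact h.dominationNumber_le_of_dominates fun v _ hv => hD v hv

lemma AttachPath.dominationNumber_le_delete [Finite V] (h : AttachPath f p x y) :
    dominationNumber T ≤ dominationNumber (T'.induce ({p}ᶜ : Set W)) + 1 := by
  have : Finite W := Finite.of_injective f f.injective
  obtain ⟨D, hD, hDc⟩ := exists_isDominating_ncard_eq (T'.induce ({p}ᶜ : Set W))
  rw [← hDc, ← Set.ncard_image_of_injective D Subtype.val_injective]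
  refine h.dominationNumber_le_of_dominates fun v hvp hv => ?_
  obtain ⟨d, hd, hvd⟩ := hD ⟨v, hvp⟩ fun hv' => hv ⟨_, hv', rfl⟩
  exact ⟨d, ⟨d, hd, rfl⟩, hvd⟩

lemma exists_attachVertex {v₀ v₁ : V} (h : T.Adj v₁ v₀) (hl : IsLeaf T v₀) :
    ∃ (W : Type u) (T' : SimpleGraph W) (f : T' ↪g T) (p : W), f p = v₁ ∧ AttachVertex f p v₀ := by
  refine ⟨({v₀}ᶜ : Set V), T.induce _, SimpleGraph.Embedding.induce _, ⟨v₁, h.ne⟩, rfl,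
    Subtype.range_coe, fun z => ⟨fun hz => hl.unique hz h.symm, ?_⟩⟩
  rintro rfl
  exact h.symm

lemma exists_attachPath {v₀ v₁ v₂ : V} (h : T.Adj v₁ v₀) (hl : IsLeaf T v₀) (h₂ : T.Adj v₁ v₂)
    (hne : v₂ ≠ v₀) (h₁ : ∀ z, T.Adj v₁ z → z = v₀ ∨ z = v₂) :
    ∃ (W : Type u) (T' : SimpleGraph W) (f : T' ↪g T) (p : W),
      f p = v₂ ∧ AttachPath f p v₁ v₀ := by
  refine ⟨({v₁, v₀}ᶜ : Set V), T.induce _, SimpleGraph.Embedding.induce _,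
    ⟨v₂, by simp [h₂.ne', hne]⟩, rfl, h.ne, Subtype.range_coe, fun z => ⟨h₁ z, ?_⟩,
    fun z => ⟨fun hz => hl.unique hz h.symm, ?_⟩⟩
  · rintro (rfl | rfl)
    exacts [h, h₂]
  · rintro rfl
    exact h.symm

/-- Replacing two vertices `x`, `y` of the partite set `A` by a common neighbour. -/
lemma IsBipartition.dominationNumber_lt [Finite V] (h : IsBipartition T A B) {v : V}
    (hx : T.Adj v x) (hy : T.Adj v y) (hxy : x ≠ y) (hxA : x ∈ A) (hyA : y ∈ A)
    (hB : ∀ b ∈ B, b ≠ v → ∃ a, T.Adj b a ∧ a ≠ x ∧ a ≠ y) : dominationNumber T < A.ncard := by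
  have hdom : IsDominating T (insert v ((A \ {x}) \ {y})) := fun u hu => by
    by_cases hux : u = x
    · exact ⟨v, Set.mem_insert _ _, hux ▸ hx.symm⟩
    by_cases huy : u = y
    · exact ⟨v, Set.mem_insert _ _, huy ▸ hy.symm⟩
    have huB := (h.mem_or u).resolve_left fun huA => hu (Or.inr ⟨⟨huA, hux⟩, huy⟩)
    obtain ⟨a, ha, hax, hay⟩ := hB u huB fun huv => hu (Or.inl huv)
    exact ⟨a, Or.inr ⟨⟨h.mem_left ha huB, hax⟩, hay⟩, ha⟩
  have h1 := TreeDom.dominationNumber_le _ (Set.toFinite _) hdom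
  have h2 := Set.ncard_insert_le v ((A \ {x}) \ {y})
  have h3 := Set.ncard_sdiff_singleton_lt_of_mem (s := A \ {x}) ⟨hyA, hxy.symm⟩ (Set.toFinite _)
  have h4 := Set.ncard_sdiff_singleton_lt_of_mem hxA (Set.toFinite _)
  omega

lemma nonempty_iso_of_unique_adj {v₀ v₁ : V} (hT : T.Connected) (h : T.Adj v₁ v₀)
    (h₀ : ∀ z, T.Adj v₀ z → z = v₁) (h₁ : ∀ z, T.Adj v₁ z → z = v₀) :
    Nonempty (T ≃g (⊤ : SimpleGraph (Fin 2))) := by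
  have hall : ∀ v, v = v₀ ∨ v = v₁ := fun v => by
    have walk : ∀ {a b : V} (_ : T.Walk a b), (a = v₀ ∨ a = v₁) → (b = v₀ ∨ b = v₁) := by
      intro a b q
      induction q with
      | nil => exact id
      | cons hadj _ ih =>
        rintro (rfl | rfl)
        · exact ih (Or.inr (h₀ _ hadj))
        · exact ih (Or.inl (h₁ _ hadj))
    obtain ⟨q⟩ := hT.preconnected v₀ v
    exact walk q (Or.inl rfl)
  have htop : T = ⊤ := by
    ext a b
    rw [SimpleGraph.top_adj]
    refine ⟨fun hab => hab.ne, fun hab => ?_⟩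
    rcases hall a with rfl | rfl <;> rcases hall b with rfl | rfl
    exacts [absurd rfl hab, h.symm, h, absurd rfl hab]
  have hcard : Nat.card V = 2 := by
    rw [Nat.card_eq_two_iff]
    exact ⟨v₀, v₁, h.ne', Set.eq_univ_of_forall fun v => hall v⟩
  have : Finite V := Nat.finite_of_card_ne_zero (by omega)
  subst htop
  exact ⟨SimpleGraph.Iso.completeGraph (Finite.equivFinOfCardEq hcard)⟩

end Reduction

/-! ### Members of `T_max` lie in both families. -/

section Families

variable {V W : Type u} {T' : SimpleGraph W} {T : SimpleGraph V} {f : T' ↪g T} {A B : Set V}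

lemma card_lt_of_embedding [Finite V] (f : T' ↪g T) {x : V} (hx : ∀ w, f w ≠ x) :
    Nat.card W < Nat.card V := by
  have := Finite.of_injective f f.injective
  simpa using ncard_preimage_lt f (Set.mem_univ x) hx

lemma dominationNumber_pos [Finite V] [Nonempty V] (G : SimpleGraph V) :
    0 < dominationNumber G := by
  obtain ⟨D, hD, hDc⟩ := exists_isDominating_ncard_eq G
  rw [← hDc, Set.ncard_pos]
  obtain ⟨v⟩ := ‹Nonempty V›
  by_cases hv : v ∈ D
  · exact ⟨v, hv⟩
  · obtain ⟨u, hu, -⟩ := hD v hv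
    exact ⟨u, hu⟩

lemma IsBipartition.ncard_add_ncard [Finite V] (h : IsBipartition T A B) :
    A.ncard + B.ncard = Nat.card V := by
  rw [← Set.ncard_union_eq h.1.disjoint, h.2, Set.ncard_univ]

/-- The size condition on the bipartition of `T'` is automatic: its second part also dominates `T'`,
while the first has size `γ(T')`. -/
lemma families_of_operation [Finite W] [Nontrivial W] (hT' : T'.IsTree)
    (hAB : IsBipartition T A B) (hγ : dominationNumber T' = (f ⁻¹' A).ncard)
    (h : Operation f (f ⁻¹' A) (f ⁻¹' B))
    (ih : InFamily T' ∧ InLabelledFamily T' (f ⁻¹' A) (f ⁻¹' B)) :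
    InFamily T ∧ InLabelledFamily T A B :=
  ⟨.step T' T f _ _ ih.1 (hAB.preimage f)
      (hγ ▸ (hAB.preimage f).symm.dominationNumber_le hT'.connected) h,
    .step T' T f _ _ A B ih.2 h hAB (Set.image_preimage_subset _ _)
      (Set.image_preimage_subset _ _)⟩

/-- The induction carries the labels `A`, `B` and only `γ = |A|`, so one argument builds both kinds
of sequence. -/
theorem families_of_dominationNumber_eq (n : ℕ) : ∀ {V : Type u} [Finite V] [Nontrivial V]
    (T : SimpleGraph V) (A B : Set V), Nat.card V = n → T.IsTree → IsBipartition T A B →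
    dominationNumber T = A.ncard → InFamily T ∧ InLabelledFamily T A B := by
  induction n using Nat.strong_induction_on with
  | _ n ih =>
  intro V _ _ T A B hn hT hAB hγ
  obtain ⟨v₀, v₁, h10, hl, huniq⟩ := exists_leaf_of_isTree hT
  have h0 : ∀ z, T.Adj v₀ z → z = v₁ := fun z hz => hl.unique hz h10.symm
  by_cases hother : ∃ l, T.Adj v₁ l ∧ IsLeaf T l ∧ l ≠ v₀
  · obtain ⟨l, h1l, hll, hl0⟩ := hother
    rcases hAB.mem_or v₀ with hv₀ | hv₀
    · have := hAB.dominationNumber_lt h10 h1l hl0.symm hv₀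
        (hAB.mem_left h1l (hAB.mem_right h10.symm hv₀)) fun b _ hb => by
          obtain ⟨a, ha⟩ := exists_adj hT.connected b
          refine ⟨a, ha, ?_, ?_⟩
          · rintro rfl
            exact hb (h0 _ ha.symm)
          · rintro rfl
            exact hb (hll.unique ha.symm h1l.symm)
      omega
    · obtain ⟨W, T', f, p, rfl, hf⟩ := exists_attachVertex h10 hl
      have : Finite W := Finite.of_injective f f.injective
      obtain ⟨l, rfl⟩ := (hf.eq_or l).resolve_left hl0
      have : Nontrivial W := ⟨p, l, fun h => h1l.ne (h ▸ rfl)⟩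
      have hT' := hf.isTree hT
      have hlt : Nat.card W < n :=
        hn ▸ card_lt_of_embedding f hf.ne
      have h1 := (hAB.preimage f).dominationNumber_le hT'.connected
      have h2 := hf.dominationNumber_le hll h1l hl0
      have h3 := ncard_preimage_le f A
      have hγ' : dominationNumber T' = (f ⁻¹' A).ncard := by omega
      exact families_of_operation hT' hAB hγ' (.O1 p (hAB.mem_left h10.symm hv₀) v₀ hf)
        (ih _ hlt T' _ _ rfl hT' (hAB.preimage f) hγ')
  · push Not at hother
    by_cases h2 : ∃ v₂, T.Adj v₁ v₂ ∧ v₂ ≠ v₀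
    · obtain ⟨v₂, h12, h20⟩ := h2
      have hl2 : ¬ IsLeaf T v₂ := fun h => h20 (hother v₂ h12 h)
      have h1 : ∀ z, T.Adj v₁ z → z = v₀ ∨ z = v₂ := fun z hz => by
        by_cases hz0 : z = v₀
        · exact Or.inl hz0
        · exact Or.inr (huniq z v₂ hz h12 (fun h => hz0 (hother z hz h)) hl2)
      obtain ⟨W, T', f, p, rfl, hf⟩ := exists_attachPath h10 hl h12 h20 h1
      have : Finite W := Finite.of_injective f f.injective
      -- If `p` were isolated in `T'`, then `v₂` would be a second leaf at `v₁`.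
      have hnt : ∃ w, T'.Adj p w := by
        by_contra hw
        push Not at hw
        refine hl2 ⟨v₁, h12.symm, fun z hz => ?_⟩
        rcases hf.eq_or z with rfl | rfl | ⟨w, rfl⟩
        · rfl
        · exact absurd (h0 _ hz.symm) h12.ne'
        · exact absurd (f.map_adj_iff.1 hz) (hw w)
      have : Nontrivial W := by
        obtain ⟨w, hw⟩ := hnt
        exact ⟨p, w, hw.ne⟩
      have hT' := hf.isTree hT
      have hlt : Nat.card W < n :=
        hn ▸ card_lt_of_embedding f hf.ne_right
      have h3 := (hAB.preimage f).dominationNumber_le hT'.connected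
      have h4 := hf.dominationNumber_le
      -- One of the adjacent vertices `v₀`, `v₁` lies in `A`. Hence `γ(T') ≤ |A ∩ T'| ≤ |A| - 1 =
      -- γ(T) - 1 ≤ γ(T')`, with equality throughout.
      have h5 : (f ⁻¹' A).ncard < A.ncard := by
        rcases hAB.mem_or v₀ with hv₀ | hv₀
        · exact ncard_preimage_lt f hv₀ hf.ne_right
        · exact ncard_preimage_lt f (hAB.mem_left h10.symm hv₀) hf.ne_left
      have hγ' : dominationNumber T' = (f ⁻¹' A).ncard := by omega
      refine families_of_operation hT' hAB hγ' ?_ (ih _ hlt T' _ _ rfl hT' (hAB.preimage f) hγ')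
      rcases hAB.mem_or v₀ with hv₀ | hv₀
      · have hv₁ := hAB.mem_right h10.symm hv₀
        have hv₂ := hAB.mem_left h12 hv₁
        refine .O3 p hv₂ ?_ v₀ v₁ hf
        by_contra hS
        -- Exchange `v₀` and `v₂` for `v₁`. A vertex of `B` other than `v₁` left without a neighbour
        -- would have `v₂` as its only neighbour, making `p` a support of `T'`.
        have := hAB.dominationNumber_lt h10 h12 h20.symm hv₀ hv₂ fun b _ hb => by
          by_contra hno
          push Not at hno
          obtain ⟨a, ha⟩ := exists_adj hT.connected b
          have hb2 : ∀ z, T.Adj b z → z = f p := fun z hz => hno z hz fun hz0 =>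
            hb (h0 b (hz0 ▸ hz.symm))
          have hbp : T.Adj b (f p) := hb2 a ha ▸ ha
          rcases hf.eq_or b with rfl | rfl | ⟨b, rfl⟩
          · exact hb rfl
          · exact h12.ne' (h0 _ hbp)
          · exact hS ⟨b, f.map_adj_iff.1 hbp.symm, p, f.map_adj_iff.1 hbp, fun z hz =>
              f.injective (hb2 _ (f.map_adj_iff.2 hz))⟩
        omega
      · refine .O4 p (hAB.mem_right h12 (hAB.mem_left h10.symm hv₀)) ?_ v₁ v₀ hf
        -- Here `γ(T') + 1 = γ(T) ≤ γ(T' - p) + 1`, so `p` is not critical.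
        have := hf.dominationNumber_le_delete
        unfold IsGammaMinusCritical
        omega
    · push Not at h2
      have hiso := nonempty_iso_of_unique_adj hT.connected h10 h0 h2
      exact ⟨.base T hiso, .base T A B hiso hAB⟩

end Families

/-! ### The invariant `γ = |A|` along both kinds of sequence. -/

section Invariant

variable {V W : Type u} {T' : SimpleGraph W} {T : SimpleGraph V} {f : T' ↪g T} {A' B' : Set W}
  {A B : Set V}

/-- The property of `(T, A, B)` that all operations preserve. -/
structure IsExtremal (T : SimpleGraph V) (A B : Set V) : Prop where
  finite : Finite V
  nontrivial : Nontrivial V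
  connected : T.Connected
  isBipartition : IsBipartition T A B
  dominationNumber_eq : dominationNumber T = A.ncard

lemma IsExtremal.ncard_le (h : IsExtremal T A B) : A.ncard ≤ B.ncard := by
  have := h.finite
  have := h.nontrivial
  exact h.dominationNumber_eq ▸ h.isBipartition.symm.dominationNumber_le h.connected

lemma IsExtremal.of_iso (h : Nonempty (T ≃g (⊤ : SimpleGraph (Fin 2))))
    (hAB : IsBipartition T A B) : IsExtremal T A B := by
  obtain ⟨e⟩ := h
  have hfin : Finite V := Finite.of_equiv _ e.symm.toEquiv
  have hnt : Nontrivial V := e.toEquiv.nontrivial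
  have hconn : T.Connected := e.connected_iff.2 SimpleGraph.connected_top
  refine ⟨hfin, hnt, hconn, hAB, ?_⟩
  -- Both parts have size at least `γ ≥ 1` and together have two vertices, so all three numbers are
  -- 1.
  have h1 := hAB.dominationNumber_le hconn
  have h2 := hAB.symm.dominationNumber_le hconn
  have h3 := hAB.ncard_add_ncard
  have h4 := dominationNumber_pos T
  rw [Nat.card_congr e.toEquiv, Nat.card_fin] at h3
  omega

/-- A squeeze: `Operation.add_ncard_le` yields `γ(T) ≥ |A|`, and `A` being dominating yields the
reverse. -/
lemma IsExtremal.step (h : IsExtremal T' A' B') (hop : Operation f A' B')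
    (hAB : IsBipartition T A B) (hA : f '' A' ⊆ A) (hB : f '' B' ⊆ B) : IsExtremal T A B := by
  have := h.finite
  have := h.nontrivial
  have hfin : Finite V := hop.finite
  have hnt : Nontrivial V := f.injective.nontrivial
  have hconn := hop.connected h.connected
  refine ⟨hfin, hnt, hconn, hAB, ?_⟩
  have h1 := hop.add_ncard_le h.connected h.isBipartition hAB hA hB
  have h2 := hAB.dominationNumber_le hconn
  have h3 := h.dominationNumber_eq
  omega

theorem InLabelledFamily.isExtremal (h : InLabelledFamily T A B) : IsExtremal T A B := by
  induction h with
  | base T A B h hAB => exact .of_iso h hAB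
  | step T' T f A' B' A B _ hop hAB hA hB ih => exact ih.step hop hAB hA hB

theorem InFamily.exists_isExtremal (h : InFamily T) : ∃ A B, IsExtremal T A B := by
  induction h with
  | base T h =>
    obtain ⟨e⟩ := h
    refine ⟨{v | e v = 0}, {v | e v = 1}, .of_iso ⟨e⟩ (isBipartition_of_forall
      (fun v => ?_) fun v w hvw => ?_)⟩
    · simp only [Set.mem_ofPred_eq]
      omega
    · have := e.map_adj_iff.2 hvw
      simp only [SimpleGraph.top_adj] at this
      simp only [Set.mem_ofPred_eq]
      omega
  | step T' T f A' B' _ hAB hle hop ih =>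
    obtain ⟨A₀, B₀, h₀⟩ := ih
    obtain ⟨A, B, hT, hA, hB⟩ := hop.exists_isBipartition hAB
    refine ⟨A, B, IsExtremal.step ⟨h₀.finite, h₀.nontrivial, h₀.connected, hAB, ?_⟩ hop hT hA hB⟩
    rw [h₀.dominationNumber_eq]
    -- The bipartition chosen for the operation may be the swap of the extremal one. Then each part
    -- is at most as large as the other, so `γ` equals the size of either.
    rcases h₀.isBipartition.eq_or_swap hAB h₀.connected with ⟨rfl, rfl⟩ | ⟨rfl, rfl⟩
    · rfl
    · exact h₀.ncard_le.antisymm hle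

lemma IsExtremal.inTmax (h : IsExtremal T A B) (hT : T.IsTree) : InTmax T :=
  ⟨hT, A, B, h.isBipartition, h.ncard_le, h.dominationNumber_eq⟩

lemma InTmax.families [Finite V] (h : InTmax T) :
    InFamily T ∧ ∃ A B : Set V, InLabelledFamily T A B := by
  obtain ⟨hT, A, B, hAB, hle, hγ⟩ := h
  have : Nonempty V := hT.connected.nonempty
  -- The one-vertex tree is excluded: its smaller part is empty while `γ` is positive.
  have hnt : Nontrivial V := by
    have h1 := dominationNumber_pos T
    have h2 := hAB.ncard_add_ncard
    exact Finite.one_lt_card_iff_nontrivial.1 (by omega)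
  have := families_of_dominationNumber_eq _ T A B rfl hT hAB hγ
  exact ⟨this.1, A, B, this.2⟩

end Invariant

end TreeDom

theorem mainTheorem3 {V : Type u} [Finite V] (T : SimpleGraph V) (hT : T.IsTree) :
    (TreeDom.InTmax T ↔ TreeDom.InFamily T) ∧
    (TreeDom.InTmax T ↔ ∃ A B : Set V, TreeDom.InLabelledFamily T A B) := by
  refine ⟨⟨fun h => h.families.1, fun h => ?_⟩, ⟨fun h => h.families.2, ?_⟩⟩
  · obtain ⟨A, B, hAB⟩ := h.exists_isExtremal
    exact hAB.inTmax hT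
  · rintro ⟨A, B, h⟩
    exact h.isExtremal.inTmax hT
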